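/- For measurable $u:\mathbb R\to\mathbb C$ and $r>0$ put $\|u\|_{r}=\bigl(\int_{\mathbb R}e^{r|\omega|}|u(\omega)|^2\,d\omega\bigr)^{1/2}\in[0,\infty]$, and for $x\in L_2(\mathbb R;\mathbb C)$ let $X(i\omega)=\int_{\mathbb R}e^{-i\omega t}x(t)\,dt$ denote its ($L_2$) Fourier transform. Let $\mathcal X(r)$ be the set of real-valued $x\in L_2(\mathbb R;\mathbb C)$ with $\|X(i\,\cdot)\|_{r}<\infty$, and $\mathcal U(r)$ the set of $x\in\mathcal X(r)$ with $\|X(i\,\cdot)\|_{r}\le 1$. For $T>0$, $\theta\ge 0$ let $\mathcal H$ be the set of all $h\in C^\infty(\mathbb R;\mathbb R)$ with $h(t)=0$ for $t\notin[-T,\theta]$. For $\tau>0$ let $\widehat{\mathcal H}(\tau)$ be the set of all $\widehat h\in L_2(\mathbb R;\mathbb C)$ with $\widehat h(t)=0$ for $t\notin[0,\tau]$ whose Laplace transform $\int_0^\infty e^{-zt}\widehat h(t)\,dt$ belongs to the Hardy spaces $\mathbb H^2\cap\mathbb H^\infty$ of the half plane $\{\operatorname{Re} z>0\}$. For a process $x$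 put $$y(t)=\int_t^{t+T}h(t-s)x(s)\,ds,\qquad \widehat y_d(t)=\int_{t-\tau}^{t}\widehat h_d(t-s)x(s)\,ds .$$ **Theorem.** Let $r>0$, $T>0$, $\theta\ge 0$ and $\tau=T+\theta$. (i) The class $\mathcal X(r)$ is linearly weakly $(T+\theta,\theta)$-predictable with the prediction horizon $T$: for every $h\in\mathcal H$ there is a sequence $\{\widehat h_d\}_{d\ge1}\subset\widehat{\mathcal H}(T+\theta)$ such that $\sup_{t\in\mathbb R}|y(t)-\widehat y_d(t)|\to0$ as $d\to\infty$ for every $x\in\mathcal X(r)$. (ii) The class $\mathcal U(r)$ is linearly weakly $(T+\theta,\theta)$-predictable with the prediction horizon $T$ uniformly with respect to the norm $\|\cdot\|_{r}$: for every $h\in\mathcal H$ there is a sequence $\{\widehat h_d\}_{d\ge1}\subset\widehat{\mathcal H}(T+\theta)$ such that $\sup_{t\in\mathbb R}|y(t)-\widehat y_d(t)|\to0$ as $d\to\infty$ uniformly in $x\in\mathcal U(r)$. -/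

import Mathlib

open MeasureTheory Filter Topology
open scoped ENNReal FourierTransform

noncomputable section

namespace WeakPrediction

/-- The Fourier transform on the imaginary axis, `X(iω) = ∫ e^{-iωt} x(t) dt`, as a function of
`ω : ℝ`, for `x` in `L₂(ℝ; ℂ)` or in `L₁(ℝ; ℂ)`.  On `L₂` it is the Plancherel transform; since
the Mathlib transform `𝓕` has kernel `e^{-2πiξt}`, one has `X(iω) = (𝓕 x)(ω / 2π)`.
It is determined up to equality almost everywhere. -/
def fourierAxis (x : ℝ → ℂ) : ℝ → ℂ :=
  open Classical in
  if hx : MemLp x 2 volume then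
    fun ω => (𝓕 (hx.toLp x) : Lp ℂ 2 (volume : Measure ℝ)) (ω / (2 * Real.pi))
  else
    fun ω => ∫ t : ℝ, Complex.exp (-(Complex.I * ω * t)) * x t

/-- The Laplace transform `∫_0^∞ e^{-zt} x(t) dt`. -/
def laplace (x : ℝ → ℂ) (z : ℂ) : ℂ :=
  ∫ t in Set.Ioi (0 : ℝ), Complex.exp (-(z * t)) * x t

/-- Membership in the Hardy space `ℍ^p` of the right half plane: `F` is holomorphic on
`{Re z > 0}` and `sup_{s > 0} ‖F(s + i ·)‖_{L_p(ℝ)}` is finite. -/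
def MemHardy (p : ℝ≥0∞) (F : ℂ → ℂ) : Prop :=
  DifferentiableOn ℂ F {z : ℂ | 0 < z.re} ∧
    (⨆ (s : ℝ) (_ : 0 < s), eLpNorm (fun ω : ℝ => F (s + Complex.I * ω)) p volume) < ⊤

/-- The kernels defining the anticausal convolutions: real valued, infinitely differentiable on
`ℝ`, and vanishing outside `[-T, θ]`. -/
def targetKernels (θ T : ℝ) : Set (ℝ → ℝ) :=
  {h | ContDiff ℝ ((⊤ : ℕ∞) : WithTop ℕ∞) h ∧ ∀ t, t ∉ Set.Icc (-T) θ → h t = 0}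

/-- The predicting kernels with memory `τ`: functions in `L₂(ℝ; ℂ)` that vanish outside `[0, τ]`
and whose Laplace transform is in `ℍ² ∩ ℍ^∞`. -/
def predictingKernels (τ : ℝ) : Set (ℝ → ℂ) :=
  {g | MemLp g 2 volume ∧ (∀ t, t ∉ Set.Icc 0 τ → g t = 0) ∧
    MemHardy 2 (laplace g) ∧ MemHardy ⊤ (laplace g)}

/-- The anticausal convolution `y(t) = ∫_t^{t+T} h(t-s) x(s) ds`. -/
def target (T : ℝ) (h : ℝ → ℝ) (x : ℝ → ℂ) (t : ℝ) : ℂ :=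
  ∫ s in t..(t + T), (h (t - s) : ℂ) * x s

/-- The causal convolution `ŷ(t) = ∫_{t-τ}^t g(t-s) x(s) ds`. -/
def prediction (τ : ℝ) (g : ℝ → ℂ) (x : ℝ → ℂ) (t : ℝ) : ℂ :=
  ∫ s in (t - τ)..t, g (t - s) * x s

/-- The prediction error `sup_{t ∈ ℝ} |y(t) - ŷ(t)|`, with values in `[0, ∞]`. -/
def predictionError (T τ : ℝ) (h : ℝ → ℝ) (g : ℝ → ℂ) (x : ℝ → ℂ) : ℝ≥0∞ :=
  ⨆ t : ℝ, ‖target T h x t - prediction τ g x t‖ₑ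

/-- The class `𝒳` is linearly weakly `(τ, θ)`-predictable with the prediction horizon `T`. -/
def IsWeaklyPredictable (𝒳 : Set (ℝ → ℂ)) (τ θ T : ℝ) : Prop :=
  ∀ h ∈ targetKernels θ T, ∃ g : ℕ → ℝ → ℂ, (∀ d, g d ∈ predictingKernels τ) ∧
    ∀ x ∈ 𝒳, Tendsto (fun d => predictionError T τ h (g d) x) atTop (𝓝 0)

/-- The class `𝒳` is linearly weakly `(τ, θ)`-predictable with the prediction horizon `T`,
uniformly with respect to the norm `N` on Fourier transforms. -/
def IsUniformlyWeaklyPredictable (𝒳 : Set (ℝ → ℂ)) (N : (ℝ → ℂ) → ℝ≥0∞) (τ θ T : ℝ) : Prop :=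
  ∀ h ∈ targetKernels θ T, ∃ g : ℕ → ℝ → ℂ, (∀ d, g d ∈ predictingKernels τ) ∧
    Tendsto (fun d => ⨆ x ∈ {x ∈ 𝒳 | N (fourierAxis x) ≤ 1}, predictionError T τ h (g d) x)
      atTop (𝓝 0)

/-- The weighted norm `(∫ e^{r|ω|} |u(ω)|² dω)^{1/2}`, with values in `[0, ∞]`. -/
def weightedNorm (r : ℝ) (u : ℝ → ℂ) : ℝ≥0∞ :=
  (∫⁻ ω : ℝ, ENNReal.ofReal (Real.exp (r * |ω|)) * ‖u ω‖ₑ ^ 2) ^ (1 / 2 : ℝ)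

/-- The class `𝒳(r)`: real valued processes in `L₂` whose Fourier transform has a finite
weighted norm. -/
def processClass (r : ℝ) : Set (ℝ → ℂ) :=
  {x | (∀ t, (x t).im = 0) ∧ MemLp x 2 volume ∧ weightedNorm r (fourierAxis x) < ⊤}

/-- The class `𝒰(r)`: the unit ball of `𝒳(r)`. -/
def unitBallClass (r : ℝ) : Set (ℝ → ℂ) :=
  {x ∈ processClass r | weightedNorm r (fourierAxis x) ≤ 1}

end WeakPrediction

end

namespace WeakPrediction

open MeasureTheory Filter Topology
open scoped ENNReal FourierTransform
open scoped ContDiff ComplexConjugate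


/-! With `k = h · 1_[-T,0)`, the error is the convolution of `k - g` with `x`. Fourier inversion and
a weighted Cauchy-Schwarz inequality bound it, uniformly in `t`, by the `L₂(e^{-c|ξ|} dξ)` norm of
`𝓕 (k - g)` times the weighted norm of `x`, where `c = 2πr` (`predictionError_le`). So it suffices
to approximate `𝓕 k` in that space by transforms of smooth `g` supported in `(0, τ)`.

This works although `k` lives on negative times. If `F` annihilates all such `𝓕 g`, then the Fourier
transform of `F e^{-c|ξ|} dξ` vanishes on `(0, τ)`. The exponential weight makes this transform
holomorphic in a strip around the line, so it vanishes everywhere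
(`fourierIntegral_expMeasure_eq_zero`), and `F` annihilates `𝓕 k` too
(`mem_closure_fourierTestSpace`). The choice of `g` depends only on `h`, which gives uniformity in
`x`. -/

/-! ### Exponential weights and quasi-analyticity -/

lemma integrable_exp_neg_mul_abs {c : ℝ} (hc : 0 < c) :
    Integrable fun ξ : ℝ => Real.exp (-(c * |ξ|)) := by
  have h := (integrableOn_exp_mul_Ioi (a := -c) (by linarith) 0)
  have h2 := (integrableOn_exp_mul_Iic (a := c) hc 0)
  rw [← integrableOn_univ, ← Set.Iic_union_Ioi (a := (0 : ℝ))]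
  refine IntegrableOn.union (h2.congr_fun (fun x hx => ?_) measurableSet_Iic)
    (h.congr_fun (fun x hx => ?_) measurableSet_Ioi)
  · simp only [abs_of_nonpos (Set.mem_Iic.1 hx)]; ring_nf
  · simp only [abs_of_pos (Set.mem_Ioi.1 hx)]; ring_nf

/-- The measure `e^{-c|ξ|} dξ`. -/
noncomputable def expMeasure (c : ℝ) : Measure ℝ :=
  volume.withDensity fun ξ => ENNReal.ofReal (Real.exp (-(c * |ξ|)))

lemma integrable_expMeasure_exp {b c : ℝ} (hbc : b < c) :
    Integrable (fun ξ : ℝ => Real.exp (b * |ξ|)) (expMeasure c) := by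
  unfold expMeasure
  rw [integrable_withDensity_iff (by fun_prop) (by simp)]
  refine (integrable_exp_neg_mul_abs (sub_pos.2 hbc)).congr (ae_of_all _ fun ξ => ?_)
  simp only
  rw [ENNReal.toReal_ofReal (Real.exp_pos _).le, ← Real.exp_add]
  ring_nf

lemma isFiniteMeasure_expMeasure {c : ℝ} (hc : 0 < c) : IsFiniteMeasure (expMeasure c) := by
  have h := integrable_expMeasure_exp hc
  simp only [zero_mul, Real.exp_zero] at h
  exact (integrable_const_iff_isFiniteMeasure one_ne_zero).1 h

lemma memLp_expMeasure_exp {b c : ℝ} (hbc : 2 * b < c) :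
    MemLp (fun ξ : ℝ => Real.exp (b * |ξ|)) 2 (expMeasure c) := by
  rw [memLp_two_iff_integrable_sq (by fun_prop)]
  refine (integrable_expMeasure_exp hbc).congr (ae_of_all _ fun ξ => ?_)
  simp only
  rw [← Real.exp_nat_mul]
  push_cast; ring_nf

/-- A two sided Laplace transform is holomorphic on a vertical strip of absolute convergence. -/
lemma differentiableOn_integral_cexp_mul {ν : Measure ℝ} {F : ℝ → ℂ} {δ : ℝ}
    (hFm : AEStronglyMeasurable F ν)
    (hF : Integrable (fun t => Real.exp (δ * |t|) * ‖F t‖) ν) :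
    DifferentiableOn ℂ (fun z : ℂ => ∫ t : ℝ, Complex.exp (z * t) * F t ∂ν)
      {z | |z.re| < δ} := by
  intro z₀ hz₀
  have hz₀' : |z₀.re| < δ := hz₀
  -- Half the distance to the edge of the strip: the spare factor `e^{ε|t|}` absorbs the `|t|`
  -- produced by differentiation.
  set ε := (δ - |z₀.re|) / 2 with hε
  have hε0 : 0 < ε := by linarith
  have hre : ∀ z ∈ Metric.ball z₀ ε, |z.re| ≤ δ - ε := by
    intro z hz
    have h1 : |z.re - z₀.re| < ε := by
      rw [← Complex.sub_re]
      exact (Complex.abs_re_le_norm _).trans_lt (by simpa [dist_eq_norm] using hz)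
    have h2 : |z.re| ≤ |z.re - z₀.re| + |z₀.re| := by
      simpa using abs_add_le (z.re - z₀.re) z₀.re
    linarith
  have hnorm : ∀ z ∈ Metric.ball z₀ ε, ∀ t : ℝ,
      ‖Complex.exp (z * t)‖ ≤ Real.exp ((δ - ε) * |t|) := by
    intro z hz t
    rw [Complex.norm_exp, Real.exp_le_exp]
    simp only [Complex.mul_re, Complex.ofReal_re, Complex.ofReal_im, mul_zero, sub_zero]
    calc z.re * t ≤ |z.re| * |t| := by rw [← abs_mul]; exact le_abs_self _
      _ ≤ _ := by gcongr; exact hre z hz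
  have hmem : z₀ ∈ Metric.ball z₀ ε := Metric.mem_ball_self hε0
  have hmeas : ∀ z : ℂ, AEStronglyMeasurable (fun t : ℝ => Complex.exp (z * t) * F t) ν :=
    fun z => (Continuous.aestronglyMeasurable (by fun_prop)).mul hFm
  have key := hasDerivAt_integral_of_dominated_loc_of_deriv_le (𝕜 := ℂ) (μ := ν)
    (F := fun z t => Complex.exp (z * t) * F t) (x₀ := z₀)
    (F' := fun z t => (t : ℂ) * Complex.exp (z * t) * F t)
    (bound := fun t => ε⁻¹ * (Real.exp (δ * |t|) * ‖F t‖))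
    (Metric.ball_mem_nhds z₀ hε0) (Eventually.of_forall hmeas)
    (hF.mono' (hmeas z₀) (ae_of_all _ fun t => ?_))
    ((Continuous.aestronglyMeasurable (by fun_prop)).mul hFm)
    (ae_of_all _ fun t z hz => ?_) (hF.const_mul _) (ae_of_all _ fun t z hz => ?_)
  · exact key.2.differentiableAt.differentiableWithinAt
  · rw [norm_mul]
    gcongr
    refine (hnorm z₀ hmem t).trans ?_
    gcongr
    linarith
  · rw [norm_mul, norm_mul, ← mul_assoc]
    refine mul_le_mul_of_nonneg_right ?_ (norm_nonneg _)
    have h1 : |t| ≤ ε⁻¹ * Real.exp (ε * |t|) := by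
      rw [inv_mul_eq_div, le_div_iff₀ hε0]
      linarith [Real.add_one_le_exp (ε * |t|)]
    calc ‖(t : ℂ)‖ * ‖Complex.exp (z * t)‖
        ≤ (ε⁻¹ * Real.exp (ε * |t|)) * Real.exp ((δ - ε) * |t|) := by
          gcongr
          · simpa using h1
          · exact hnorm z hz t
      _ = _ := by rw [mul_assoc, ← Real.exp_add]; ring_nf
  · have h1 : HasDerivAt (fun z : ℂ => z * (t : ℂ)) t z := by
      simpa using (hasDerivAt_id z).mul_const (t : ℂ)
    exact (h1.cexp.mul_const (F t)).congr_deriv (by ring)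

/-- By duality the hypothesis says that the transform of `F` is weakly zero on `(0, τ)`, hence zero
there by continuity. The identity theorem in the strip propagates this to the whole line, however
small `τ` is. -/
lemma fourierIntegral_expMeasure_eq_zero {c τ : ℝ} (hc : 0 < c) (hτ : 0 < τ) {F : ℝ → ℂ}
    (hF : MemLp F 2 (expMeasure c))
    (h : ∀ g : ℝ → ℂ, ContDiff ℝ ∞ g → HasCompactSupport g → tsupport g ⊆ Set.Ioo 0 τ →
      ∫ ξ, 𝓕 g ξ * F ξ ∂(expMeasure c) = 0) (t : ℝ) :
    VectorFourier.fourierIntegral Real.fourierChar (expMeasure c) (innerₗ ℝ) F t = 0 := by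
  have := isFiniteMeasure_expMeasure hc
  have hF1 : Integrable F (expMeasure c) := hF.integrable one_le_two
  set φ : ℝ → ℂ :=
    VectorFourier.fourierIntegral Real.fourierChar (expMeasure c) (innerₗ ℝ) F with hφ
  set M : ℂ → ℂ := fun z => ∫ ξ : ℝ, Complex.exp (z * ξ) * F ξ ∂(expMeasure c) with hM
  have hφM : ∀ t : ℝ, φ t = M (-(2 * Real.pi * Complex.I) * t) := by
    intro t
    simp only [hφ, hM, VectorFourier.fourierIntegral]
    congr 1 with ξ
    rw [Circle.smul_def, Real.fourierChar_apply, smul_eq_mul]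
    congr 2
    simp
    ring
  have hcont : Continuous φ :=
    VectorFourier.fourierIntegral_continuous Real.continuous_fourierChar (by fun_prop) hF1
  have hzero : ∀ t ∈ Set.Ioo 0 τ, φ t = 0 := by
    have hae : ∀ᵐ t : ℝ, t ∈ Set.Ioo 0 τ → φ t = 0 := by
      refine isOpen_Ioo.ae_eq_zero_of_integral_contDiff_smul_eq_zero
        (hcont.locallyIntegrable.locallyIntegrableOn _) fun g hg hgs hgt => ?_
      have hsupp : Function.support (fun x => (g x : ℂ)) = Function.support g := by
        ext; simp
      have hg1 : HasCompactSupport fun x => (g x : ℂ) := by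
        unfold HasCompactSupport tsupport; rw [hsupp]; exact hgs
      have hg2 : ContDiff ℝ ∞ fun x => (g x : ℂ) := Complex.ofRealCLM.contDiff.comp hg
      have := h (fun x => (g x : ℂ)) hg2 hg1 (by unfold tsupport; rw [hsupp]; exact hgt)
      rw [← this]
      have key := VectorFourier.integral_fourierIntegral_smul_eq_flip (L := innerₗ ℝ)
        (μ := (volume : Measure ℝ)) (ν := expMeasure c) Real.continuous_fourierChar
        (by fun_prop) (hg2.continuous.integrable_of_hasCompactSupport hg1) hF1
      rw [flip_innerₗ] at key
      simp only [smul_eq_mul] at key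
      simp only [Complex.real_smul]
      exact key.symm
    intro t ht
    by_contra hne
    have hopen : IsOpen ({t | φ t ≠ 0} ∩ Set.Ioo 0 τ) :=
      (isOpen_ne_fun hcont continuous_const).inter isOpen_Ioo
    refine (hopen.measure_pos volume ⟨t, hne, ht⟩).ne' ?_
    refine measure_mono_null (fun s hs => ?_) hae
    simp only [Set.mem_compl_iff, Set.mem_ofPred_eq, Classical.not_imp]
    exact ⟨hs.2, hs.1⟩
  -- Cauchy-Schwarz against `F` needs `e^{2b|ξ|}` integrable for the weight `e^{-c|ξ|}`; any
  -- positive `b < c / 2` would serve, and `b = c / 4` is taken.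
  have hdiff : DifferentiableOn ℂ M {z | |z.re| < c / 4} := by
    refine differentiableOn_integral_cexp_mul hF1.1 ?_
    exact (memLp_expMeasure_exp (b := c / 4) (c := c) (by linarith)).integrable_mul hF.norm
  have hopen : IsOpen {z : ℂ | |z.re| < c / 4} :=
    isOpen_lt (by fun_prop) continuous_const
  have hconv : IsPreconnected {z : ℂ | |z.re| < c / 4} := by
    have : {z : ℂ | |z.re| < c / 4} = Complex.reLm ⁻¹' (Set.Ioo (-(c / 4)) (c / 4)) := by
      ext z; simp [abs_lt]
    rw [this]
    exact ((convex_Ioo _ _).linear_preimage Complex.reLm).isPreconnected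
  have hline : ∀ t : ℝ, (-(2 * Real.pi * Complex.I) * t) ∈ {z : ℂ | |z.re| < c / 4} := by
    intro t; simp; linarith
  have hfreq : ∃ᶠ z in 𝓝[≠] (-(2 * Real.pi * Complex.I) * ((τ / 2 : ℝ) : ℂ)), M z = 0 := by
    have hev : ∀ᶠ t in 𝓝[≠] (τ / 2), M (-(2 * Real.pi * Complex.I) * (t : ℝ)) = 0 := by
      refine nhdsWithin_le_nhds ?_
      filter_upwards [Ioo_mem_nhds (half_pos hτ) (half_lt_self hτ)] with t ht
      rw [← hφM, hzero t ht]
    have htend : Tendsto (fun t : ℝ => -(2 * Real.pi * Complex.I) * (t : ℂ)) (𝓝[≠] (τ / 2))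
        (𝓝[≠] (-(2 * Real.pi * Complex.I) * ((τ / 2 : ℝ) : ℂ))) := by
      refine tendsto_nhdsWithin_iff.2 ⟨?_, ?_⟩
      · exact (Continuous.tendsto (by fun_prop) _).mono_left nhdsWithin_le_nhds
      · filter_upwards [self_mem_nhdsWithin] with t ht
        simp only [Set.mem_compl_iff, Set.mem_singleton_iff] at ht ⊢
        intro heq
        have := mul_left_cancel₀ (by simp [Real.pi_ne_zero]) heq
        exact ht (by exact_mod_cast this)
    exact htend.frequently hev.frequently
  have := (hdiff.analyticOnNhd hopen).eqOn_zero_of_preconnected_of_frequently_eq_zero hconv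
    (hline _) hfreq (hline t)
  rw [hφM]
  exact this


/-! ### Density of the transforms of test kernels -/

lemma continuous_fourier {k : ℝ → ℂ} (hk : Integrable k) : Continuous (𝓕 k) :=
  VectorFourier.fourierIntegral_continuous Real.continuous_fourierChar
    (L := innerₗ ℝ) (by fun_prop) hk

lemma memLp_fourier_expMeasure {c : ℝ} (hc : 0 < c) {k : ℝ → ℂ} (hk : Integrable k) :
    MemLp (𝓕 k) 2 (expMeasure c) := by
  have := isFiniteMeasure_expMeasure hc
  exact MemLp.of_bound (continuous_fourier hk).aestronglyMeasurable (∫ t, ‖k t‖)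
    (ae_of_all _ fun ξ =>
      VectorFourier.norm_fourierIntegral_le_integral_norm _ _ _ _ _)

lemma fourier_add {f g : ℝ → ℂ} (hf : Integrable f) (hg : Integrable g) :
    𝓕 (f + g) = 𝓕 f + 𝓕 g :=
  (VectorFourier.fourierIntegral_add Real.continuous_fourierChar (L := innerₗ ℝ) (by fun_prop)
    hf hg)

lemma fourier_sub {f g : ℝ → ℂ} (hf : Integrable f) (hg : Integrable g) :
    𝓕 (f - g) = 𝓕 f - 𝓕 g := by
  rw [eq_sub_iff_add_eq, ← fourier_add (hf.sub hg) hg, sub_add_cancel]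

/-- Smooth complex functions with compact support in the open interval `(0, τ)`. -/
def testKernels (τ : ℝ) : Submodule ℂ (ℝ → ℂ) where
  carrier := {g | ContDiff ℝ ∞ g ∧ HasCompactSupport g ∧ tsupport g ⊆ Set.Ioo 0 τ}
  add_mem' := fun hf hg => ⟨hf.1.add hg.1, hf.2.1.add hg.2.1,
    (tsupport_add _ _).trans (Set.union_subset hf.2.2 hg.2.2)⟩
  zero_mem' := ⟨contDiff_const, HasCompactSupport.zero, by simp [tsupport]⟩
  smul_mem' := fun a f hf => ⟨contDiff_const.smul hf.1, hf.2.1.smul_left,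
    (closure_mono (Function.support_const_smul_subset a f)).trans hf.2.2⟩

lemma testKernels_integrable {τ : ℝ} {g : ℝ → ℂ} (hg : g ∈ testKernels τ) : Integrable g :=
  hg.1.continuous.integrable_of_hasCompactSupport hg.2.1

/-- Fourier transforms of test kernels as a subspace of the weighted `L₂` space. -/
def fourierTestSpace (c τ : ℝ) : Submodule ℂ (Lp ℂ 2 (expMeasure c)) where
  carrier := {F | ∃ g ∈ testKernels τ, F =ᵐ[expMeasure c] 𝓕 g}
  add_mem' := by
    rintro F G ⟨f, hf, hF⟩ ⟨g, hg, hG⟩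
    refine ⟨f + g, add_mem hf hg, (Lp.coeFn_add F G).trans ?_⟩
    rw [fourier_add (testKernels_integrable hf) (testKernels_integrable hg)]
    exact hF.add hG
  zero_mem' := by
    refine ⟨0, zero_mem _, (Lp.coeFn_zero _ _ _).trans (ae_of_all _ fun ξ => ?_)⟩
    simp [Real.fourier_eq]
  smul_mem' := by
    rintro a F ⟨f, hf, hF⟩
    refine ⟨a • f, Submodule.smul_mem _ a hf, (Lp.coeFn_smul a F).trans ?_⟩
    rw [show 𝓕 (a • f) = a • 𝓕 f from VectorFourier.fourierIntegral_const_smul _ _ _ _ _]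
    exact hF.const_smul a

/-- The closure is the double orthogonal complement, and the pairing of `𝓕 k` with an orthogonal `f`
moves by duality to the transform of `conj f`, which is zero. -/
lemma mem_closure_fourierTestSpace {c τ : ℝ} (hc : 0 < c) (hτ : 0 < τ) {k : ℝ → ℂ}
    (hk : Integrable k) :
    (memLp_fourier_expMeasure hc hk).toLp (𝓕 k) ∈ (fourierTestSpace c τ).topologicalClosure := by
  have := isFiniteMeasure_expMeasure hc
  rw [← Submodule.orthogonal_orthogonal_eq_closure, Submodule.mem_orthogonal]
  intro f hf
  rw [Submodule.mem_orthogonal'] at hf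
  have hinner : ∀ (l : ℝ → ℂ) (hl : Integrable l),
      inner ℂ f ((memLp_fourier_expMeasure hc hl).toLp (𝓕 l)) =
        ∫ ξ, 𝓕 l ξ * conj (f ξ) ∂(expMeasure c) := by
    intro l hl
    rw [L2.inner_def]
    refine integral_congr_ae ?_
    filter_upwards [(memLp_fourier_expMeasure hc hl).coeFn_toLp] with ξ hξ
    rw [hξ, RCLike.inner_apply]
  have hF : MemLp (fun ξ => conj (f ξ)) 2 (expMeasure c) := (Lp.memLp f).star
  have hzero := fourierIntegral_expMeasure_eq_zero hc hτ hF fun g hg hgs hgt => by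
    have hgm : g ∈ testKernels τ := ⟨hg, hgs, hgt⟩
    rw [← hinner g (testKernels_integrable hgm)]
    exact hf _ ⟨g, hgm, MemLp.coeFn_toLp _⟩
  rw [hinner k hk]
  have key := VectorFourier.integral_fourierIntegral_smul_eq_flip (L := innerₗ ℝ)
    (μ := (volume : Measure ℝ)) (ν := expMeasure c) Real.continuous_fourierChar
    (by fun_prop) hk (hF.integrable one_le_two)
  rw [flip_innerₗ] at key
  simp only [smul_eq_mul, hzero, mul_zero, integral_zero] at key
  exact key

/-- Transforms of test kernels are dense in `L₂(e^{-c|ξ|} dξ)`, as far as transforms of integrable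
functions are concerned. -/
lemma exists_testKernels_eLpNorm_lt {c τ : ℝ} (hc : 0 < c) (hτ : 0 < τ) {k : ℝ → ℂ}
    (hk : Integrable k) {ε : ℝ≥0∞} (hε : ε ≠ 0) :
    ∃ g ∈ testKernels τ, eLpNorm (𝓕 (k - g)) 2 (expMeasure c) < ε := by
  have h := mem_closure_fourierTestSpace hc hτ hk
  rw [← SetLike.mem_coe, Submodule.topologicalClosure_coe, EMetric.mem_closure_iff] at h
  obtain ⟨G, ⟨g, hg, hG⟩, hd⟩ := h ε (pos_iff_ne_zero.2 hε)
  refine ⟨g, hg, ?_⟩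
  rw [Lp.edist_def] at hd
  rw [fourier_sub hk (testKernels_integrable hg)]
  refine (eLpNorm_congr_ae ?_).trans_lt hd
  filter_upwards [hG, (memLp_fourier_expMeasure hc hk).coeFn_toLp] with ξ h1 h2
  simp [h1, h2]

/-! ### Fourier inversion for square integrable processes -/

lemma integral_fourierInv_mul {X k : ℝ → ℂ} (hX : Integrable X) (hk : Integrable k) :
    ∫ s, k s * 𝓕⁻ X s = ∫ ξ, 𝓕⁻ k ξ * X ξ := by
  have key := VectorFourier.integral_fourierIntegral_smul_eq_flip (L := -innerₗ ℝ)
    (μ := (volume : Measure ℝ)) (ν := (volume : Measure ℝ)) Real.continuous_fourierChar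
    (by simp only [LinearMap.neg_apply, innerₗ_apply_apply]; fun_prop) hk hX
  have : (-innerₗ ℝ).flip = -innerₗ ℝ :=
    LinearMap.ext₂ fun x y => by simp [mul_comm]
  rw [this] at key
  exact key.symm

/-- Links the Plancherel transform to the inversion integral: both sides agree as tempered
distributions when tested on smooth compactly supported functions. -/
lemma coe_ae_eq_fourierInv_fourier (f : Lp ℂ 2 (volume : Measure ℝ))
    (hf : Integrable (𝓕 f : Lp ℂ 2 (volume : Measure ℝ))) :
    f =ᵐ[volume] 𝓕⁻ ((𝓕 f : Lp ℂ 2 (volume : Measure ℝ)) : ℝ → ℂ) := by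
  set X : Lp ℂ 2 (volume : Measure ℝ) := 𝓕 f with hX
  have hcont : Continuous (𝓕⁻ (X : ℝ → ℂ)) := by
    rw [Real.fourierInv_eq_fourier_comp_neg]
    exact continuous_fourier hf.comp_neg
  refine ae_eq_of_integral_contDiff_smul_eq ((Lp.memLp f).locallyIntegrable one_le_two)
    hcont.locallyIntegrable fun g hg hgs => ?_
  have hg1 : HasCompactSupport fun x => (g x : ℂ) := hgs.comp_left Complex.ofReal_zero
  have hg2 : ContDiff ℝ ∞ fun x => (g x : ℂ) := Complex.ofRealCLM.contDiff.comp hg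
  set Φ : SchwartzMap ℝ ℂ := hg1.toSchwartzMap hg2 with hΦ
  have hΦg : ∀ x, Φ x = (g x : ℂ) := fun x => rfl
  have h1 : f = 𝓕⁻ X := by rw [hX, FourierTransform.fourierInv_fourier_eq]
  have h2 := congrArg (fun u => u Φ) (Lp.fourierInv_toTemperedDistribution_eq X)
  simp only [TemperedDistribution.fourierInv_apply, Lp.toTemperedDistribution_apply,
    ← h1] at h2
  simp only [hΦg, smul_eq_mul, SchwartzMap.fourierInv_coe] at h2
  simp only [Complex.real_smul]
  rw [← h2]
  exact (integral_fourierInv_mul hf (hg2.continuous.integrable_of_hasCompactSupport hg1)).symm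

/-- A translation only contributes a phase; this makes the error bound independent of `t`. -/
lemma norm_fourierInv_comp_sub (k : ℝ → ℂ) (t ξ : ℝ) :
    ‖𝓕⁻ (fun s => k (t - s)) ξ‖ = ‖𝓕 k ξ‖ := by
  have h1 : (fun s => k (t - -s)) = k ∘ fun s => s + t := by
    ext s; simp [add_comm]
  rw [Real.fourierInv_eq_fourier_comp_neg, h1]
  have h2 := congrFun (VectorFourier.fourierIntegral_comp_add_right Real.fourierChar
    (volume : Measure ℝ) (innerₗ ℝ) k t) ξ
  exact (congrArg norm h2).trans (Circle.norm_smul _ _)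


/-! ### Hardy space bounds for test kernels -/

lemma map_volume_div_two_pi :
    Measure.map (fun w : ℝ => w / (2 * Real.pi)) volume =
      ENNReal.ofReal (2 * Real.pi) • volume := by
  have h := Real.map_volume_mul_left (a := (2 * Real.pi)⁻¹) (by positivity)
  rw [inv_inv, abs_of_pos (by positivity)] at h
  simp_rw [← h, div_eq_inv_mul]

lemma measurableEmbedding_div_two_pi :
    MeasurableEmbedding (fun w : ℝ => w / (2 * Real.pi)) := by
  simp_rw [div_eq_mul_inv]
  exact measurableEmbedding_mulRight₀ (by positivity)

lemma eLpNorm_fourier_schwartz (ψ : SchwartzMap ℝ ℂ) :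
    eLpNorm (𝓕 (ψ : ℝ → ℂ)) 2 volume = eLpNorm ψ 2 volume := by
  have h : ‖(𝓕 ψ).toLp 2 (volume : Measure ℝ)‖ₑ = ‖ψ.toLp 2 (volume : Measure ℝ)‖ₑ := by
    rw [← SchwartzMap.toLp_fourier_eq, enorm_eq_iff_norm_eq, Lp.norm_fourier_eq]
  simpa only [SchwartzMap.toLp, Lp.enorm_toLp, SchwartzMap.fourier_coe] using h

lemma laplace_eq_integral {τ : ℝ} {g : ℝ → ℂ} (hg : g ∈ testKernels τ) (z : ℂ) :
    laplace g z = ∫ t : ℝ, Complex.exp (-(z * t)) * g t := by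
  refine setIntegral_eq_integral_of_forall_compl_eq_zero fun t ht => ?_
  rw [image_eq_zero_of_notMem_tsupport fun h => ht (hg.2.2 h).1, mul_zero]

lemma norm_cexp_neg_mul_le {τ : ℝ} {g : ℝ → ℂ} (hg : g ∈ testKernels τ) {z : ℂ} (hz : 0 ≤ z.re)
    (t : ℝ) : ‖Complex.exp (-(z * t)) * g t‖ ≤ ‖g t‖ := by
  by_cases ht : t ∈ tsupport g
  · rw [norm_mul, Complex.norm_exp]
    refine mul_le_of_le_one_left (norm_nonneg _) (Real.exp_le_one_iff.2 ?_)
    simpa using mul_nonneg hz (hg.2.2 ht).1.le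
  · simp [image_eq_zero_of_notMem_tsupport ht]

lemma differentiable_laplace {τ : ℝ} {g : ℝ → ℂ} (hg : g ∈ testKernels τ) :
    Differentiable ℂ (laplace g) := by
  have hM : Differentiable ℂ fun z : ℂ => ∫ t : ℝ, Complex.exp (z * t) * g t := by
    intro z
    have hint : Integrable fun t : ℝ => Real.exp ((|z.re| + 1) * |t|) * ‖g t‖ := by
      refine Continuous.integrable_of_hasCompactSupport ?_ hg.2.1.norm.mul_left
      have := hg.1.continuous
      fun_prop
    refine (differentiableOn_integral_cexp_mul (testKernels_integrable hg).1
      hint).differentiableAt (IsOpen.mem_nhds ?_ ?_)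
    · exact isOpen_lt (by fun_prop) continuous_const
    · simp
  have h : laplace g = (fun z : ℂ => ∫ t : ℝ, Complex.exp (z * t) * g t) ∘ fun z => -z := by
    ext z
    simp [laplace_eq_integral hg]
  rw [h]
  exact hM.comp differentiable_neg

/-- Plancherel for the Schwartz function `e^{-st} g(t)`, dominated by `|g|` since `g` lives on `t >
0`; the constant comes from `ω = 2πξ`. -/
lemma eLpNorm_laplace_two_le {τ : ℝ} {g : ℝ → ℂ} (hg : g ∈ testKernels τ) {s : ℝ}
    (hs : 0 < s) :
    eLpNorm (fun w : ℝ => laplace g (s + Complex.I * w)) 2 volume ≤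
      ENNReal.ofReal (2 * Real.pi) ^ (1 / 2 : ℝ) * eLpNorm g 2 volume := by
  have hc : HasCompactSupport fun t : ℝ => Complex.exp (-(s * t)) * g t := hg.2.1.mul_left
  have hd : ContDiff ℝ ∞ fun t : ℝ => Complex.exp (-(s * t)) * g t :=
    (((contDiff_const.mul Complex.ofRealCLM.contDiff).neg).cexp).mul hg.1
  set ψ : SchwartzMap ℝ ℂ := hc.toSchwartzMap hd with hψ
  have hψt : ∀ t : ℝ, ψ t = Complex.exp (-(s * t)) * g t := fun t => rfl
  have h1 : (fun w : ℝ => laplace g (s + Complex.I * w)) =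
      𝓕 (ψ : ℝ → ℂ) ∘ fun w => w / (2 * Real.pi) := by
    ext w
    rw [laplace_eq_integral hg, Function.comp_apply, Real.fourier_real_eq_integral_exp_smul]
    congr 1 with t
    rw [hψt, smul_eq_mul, ← mul_assoc, ← Complex.exp_add]
    congr 2
    push_cast
    field_simp
    ring
  rw [h1, ← measurableEmbedding_div_two_pi.eLpNorm_map_measure, map_volume_div_two_pi,
    eLpNorm_smul_measure_of_ne_top (by simp), eLpNorm_fourier_schwartz]
  rw [smul_eq_mul, show (1 / 2 : ℝ≥0∞).toReal = 1 / 2 by simp]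
  refine mul_le_mul_right ?_ _
  refine eLpNorm_mono fun t => ?_
  exact norm_cexp_neg_mul_le hg (z := s) (by simpa using hs.le) t

lemma norm_laplace_le {τ : ℝ} {g : ℝ → ℂ} (hg : g ∈ testKernels τ) {z : ℂ} (hz : 0 ≤ z.re) :
    ‖laplace g z‖ ≤ ∫ t, ‖g t‖ := by
  rw [laplace_eq_integral hg]
  exact norm_integral_le_of_norm_le (testKernels_integrable hg).norm
    (ae_of_all _ (norm_cexp_neg_mul_le hg hz))

lemma testKernels_subset_predictingKernels (τ : ℝ) :
    (testKernels τ : Set (ℝ → ℂ)) ⊆ predictingKernels τ := by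
  intro g hg
  have hL2 : MemLp g 2 volume := hg.1.continuous.memLp_of_hasCompactSupport hg.2.1
  refine ⟨hL2, fun t ht => ?_, ⟨(differentiable_laplace hg).differentiableOn, ?_⟩,
    ⟨(differentiable_laplace hg).differentiableOn, ?_⟩⟩
  · exact image_eq_zero_of_notMem_tsupport fun h => ht (Set.Ioo_subset_Icc_self (hg.2.2 h))
  · refine (iSup₂_le (a := ENNReal.ofReal (2 * Real.pi) ^ (1 / 2 : ℝ) * eLpNorm g 2 volume)
      fun s hs => ?_).trans_lt ?_
    · exact eLpNorm_laplace_two_le hg hs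
    · exact ENNReal.mul_lt_top
        (ENNReal.rpow_lt_top_of_nonneg (by positivity) ENNReal.ofReal_ne_top) hL2.2
  · refine (iSup₂_le (a := ENNReal.ofReal (∫ t, ‖g t‖)) fun s hs => ?_).trans_lt
      ENNReal.ofReal_lt_top
    rw [eLpNorm_exponent_top]
    refine eLpNormEssSup_le_of_ae_bound (ae_of_all _ fun w => norm_laplace_le hg ?_)
    simpa using hs.le

/-! ### Weighted norms and the prediction error -/

lemma lintegral_comp_div_two_pi (f : ℝ → ℝ≥0∞) :
    ∫⁻ w, f (w / (2 * Real.pi)) = ENNReal.ofReal (2 * Real.pi) * ∫⁻ ξ, f ξ := by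
  rw [← measurableEmbedding_div_two_pi.lintegral_map, map_volume_div_two_pi,
    lintegral_smul_measure, smul_eq_mul]

/-- The weighted norm of `fourierAxis x` in terms of the transform of Mathlib. -/
lemma weightedNorm_plancherel_le {r : ℝ} {x : ℝ → ℂ} (hx : MemLp x 2 volume) :
    weightedNorm (2 * Real.pi * r) (𝓕 (hx.toLp x) : Lp ℂ 2 (volume : Measure ℝ)) ≤
      weightedNorm r (fourierAxis x) := by
  unfold weightedNorm
  gcongr ?_ ^ _
  rw [fourierAxis, dif_pos hx]
  set X : Lp ℂ 2 (volume : Measure ℝ) := 𝓕 (hx.toLp x)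
  have h := lintegral_comp_div_two_pi fun ξ =>
    ENNReal.ofReal (Real.exp (2 * Real.pi * r * |ξ|)) * ‖X ξ‖ₑ ^ 2
  have h2 : ∀ w : ℝ, 2 * Real.pi * r * |w / (2 * Real.pi)| = r * |w| := by
    intro w
    rw [abs_div, abs_of_pos (by positivity : 0 < 2 * Real.pi)]
    field_simp
  simp only [h2] at h
  rw [h]
  -- The Jacobian `2π` is at least `1` and is simply dropped.
  refine le_mul_of_one_le_left' ?_
  rw [ENNReal.one_le_ofReal]
  linarith [Real.pi_gt_three]

/-- Cauchy-Schwarz after inserting `1 = e^{-c|ξ|/2} e^{c|ξ|/2}`. -/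
lemma lintegral_enorm_mul_le_weightedNorm {c : ℝ} {D X : ℝ → ℂ}
    (hD : AEStronglyMeasurable D volume) (hX : AEStronglyMeasurable X volume) :
    ∫⁻ ξ, ‖D ξ‖ₑ * ‖X ξ‖ₑ ≤ eLpNorm D 2 (expMeasure c) * weightedNorm c X := by
  have key := ENNReal.lintegral_mul_le_Lp_mul_Lq (volume : Measure ℝ)
    Real.HolderConjugate.two_two
    (f := fun ξ => ENNReal.ofReal (Real.exp (-(c / 2 * |ξ|))) * ‖D ξ‖ₑ)
    (g := fun ξ => ENNReal.ofReal (Real.exp (c / 2 * |ξ|)) * ‖X ξ‖ₑ)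
    ((by fun_prop : Measurable fun ξ : ℝ =>
      ENNReal.ofReal (Real.exp (-(c / 2 * |ξ|)))).aemeasurable.mul hD.enorm)
    ((by fun_prop : Measurable fun ξ : ℝ =>
      ENNReal.ofReal (Real.exp (c / 2 * |ξ|))).aemeasurable.mul hX.enorm)
  have hsq : ∀ a : ℝ, ENNReal.ofReal (Real.exp a) ^ 2 = ENNReal.ofReal (Real.exp (2 * a)) := by
    intro a
    rw [← ENNReal.ofReal_pow (Real.exp_pos _).le, ← Real.exp_nat_mul]
    norm_cast
  convert key using 1
  · refine lintegral_congr fun ξ => ?_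
    rw [Pi.mul_apply, mul_mul_mul_comm, ← ENNReal.ofReal_mul (Real.exp_pos _).le,
      ← Real.exp_add]
    simp
  · congr 1
    · rw [eLpNorm_eq_lintegral_rpow_enorm_toReal (by simp) (by simp), expMeasure,
        lintegral_withDensity_eq_lintegral_mul_non_measurable _ (by fun_prop) (by simp)]
      simp only [ENNReal.toReal_ofNat, ENNReal.rpow_ofNat, mul_pow, hsq, Pi.mul_apply]
      ring_nf
    · simp only [weightedNorm, ENNReal.rpow_ofNat, mul_pow, hsq]
      ring_nf

lemma integrable_of_weightedNorm_lt_top {c : ℝ} (hc : 0 < c) {X : ℝ → ℂ}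
    (hX : AEStronglyMeasurable X volume) (hfin : weightedNorm c X < ⊤) : Integrable X := by
  have := isFiniteMeasure_expMeasure hc
  refine ⟨hX, ?_⟩
  have h := lintegral_enorm_mul_le_weightedNorm (c := c) (D := fun _ => 1)
    aestronglyMeasurable_const hX
  simp only [enorm_one, one_mul] at h
  exact h.trans_lt (ENNReal.mul_lt_top (memLp_const 1).2 hfin)

/-- An integrable transform makes `x` essentially bounded. -/
lemma integrable_comp_sub_mul {x p : ℝ → ℂ} (hx : MemLp x 2 volume)
    (hX : Integrable (𝓕 (hx.toLp x) : Lp ℂ 2 (volume : Measure ℝ))) (hp : Integrable p) (t : ℝ) :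
    Integrable fun s => p (t - s) * x s := by
  have hae := hx.coeFn_toLp.symm.trans (coe_ae_eq_fourierInv_fourier _ hX)
  refine (hp.comp_sub_left t).mul_bdd
    (c := ∫ ξ, ‖(𝓕 (hx.toLp x) : Lp ℂ 2 (volume : Measure ℝ)) ξ‖) hx.1 ?_
  filter_upwards [hae] with s hs
  rw [hs]
  exact VectorFourier.norm_fourierIntegral_le_integral_norm _ _ _ _ _

lemma enorm_integral_comp_sub_mul_le {x p : ℝ → ℂ} (hx : MemLp x 2 volume)
    (hX : Integrable (𝓕 (hx.toLp x) : Lp ℂ 2 (volume : Measure ℝ))) (hp : Integrable p) (t : ℝ) :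
    ‖∫ s, p (t - s) * x s‖ₑ ≤
      ∫⁻ ξ, ‖𝓕 p ξ‖ₑ * ‖(𝓕 (hx.toLp x) : Lp ℂ 2 (volume : Measure ℝ)) ξ‖ₑ := by
  have hae := hx.coeFn_toLp.symm.trans (coe_ae_eq_fourierInv_fourier _ hX)
  have h1 : ∫ s, p (t - s) * x s = ∫ s, p (t - s) *
      𝓕⁻ ((𝓕 (hx.toLp x) : Lp ℂ 2 (volume : Measure ℝ)) : ℝ → ℂ) s := by
    refine integral_congr_ae ?_
    filter_upwards [hae] with s hs
    rw [hs]
  rw [h1, integral_fourierInv_mul hX (hp.comp_sub_left t)]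
  refine (enorm_integral_le_lintegral_enorm _).trans (lintegral_mono fun ξ => ?_)
  rw [enorm_mul, enorm_eq_iff_norm_eq.2 (norm_fourierInv_comp_sub p t ξ)]

/-- The reflection `s ↦ t - s` turns the half-open `Ioc` of interval integrals into `Ico`. -/
lemma intervalIntegral_comp_sub_mul (k x : ℝ → ℂ) {a b : ℝ} (hab : a ≤ b) (t : ℝ) :
    ∫ s in (t - b)..(t - a), k (t - s) * x s =
      ∫ s, (Set.Ico a b).indicator k (t - s) * x s := by
  rw [intervalIntegral.integral_of_le (by linarith), ← integral_indicator measurableSet_Ioc]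
  congr 1 with s
  have hiff : s ∈ Set.Ioc (t - b) (t - a) ↔ t - s ∈ Set.Ico a b := by
    simp only [Set.mem_Ioc, Set.mem_Ico]
    constructor <;> rintro ⟨h1, h2⟩ <;> constructor <;> linarith
  by_cases hs : t - s ∈ Set.Ico a b
  · rw [Set.indicator_of_mem (hiff.2 hs), Set.indicator_of_mem hs]
  · rw [Set.indicator_of_notMem (mt hiff.1 hs), Set.indicator_of_notMem hs, zero_mul]

lemma predictionError_le {r T τ : ℝ} (hr : 0 < r) (hT : 0 ≤ T) (hτ : 0 ≤ τ) {h : ℝ → ℝ}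
    (hk : Integrable ((Set.Ico (-T) 0).indicator fun u => (h u : ℂ))) {g : ℝ → ℂ}
    (hg : g ∈ testKernels τ) {x : ℝ → ℂ} (hx : x ∈ processClass r) :
    predictionError T τ h g x ≤
      eLpNorm (𝓕 (((Set.Ico (-T) 0).indicator fun u => (h u : ℂ)) - g)) 2
        (expMeasure (2 * Real.pi * r)) * weightedNorm r (fourierAxis x) := by
  obtain ⟨-, hx2, hfin⟩ := hx
  have hle := weightedNorm_plancherel_le (r := r) hx2
  have hX := integrable_of_weightedNorm_lt_top (by positivity) (Lp.aestronglyMeasurable _)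
    (hle.trans_lt hfin)
  have hgi := testKernels_integrable hg
  refine iSup_le fun t => ?_
  have h1 : target T h x t = ∫ s, (Set.Ico (-T) 0).indicator (fun u => (h u : ℂ)) (t - s) * x s := by
    rw [← intervalIntegral_comp_sub_mul _ _ (by linarith), target, sub_zero, sub_neg_eq_add]
  have h2 : prediction τ g x t = ∫ s, g (t - s) * x s := by
    have hind : (Set.Ico 0 τ).indicator g = g := by
      refine Set.indicator_eq_self.2 fun u hu => ?_
      exact Set.Ioo_subset_Ico_self (hg.2.2 (subset_tsupport g hu))
    conv_rhs => rw [← hind]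
    rw [← intervalIntegral_comp_sub_mul _ _ hτ, sub_zero, prediction]
  rw [h1, h2, ← integral_sub (integrable_comp_sub_mul hx2 hX hk t)
    (integrable_comp_sub_mul hx2 hX hgi t)]
  simp_rw [← sub_mul]
  refine (enorm_integral_comp_sub_mul_le hx2 hX (hk.sub hgi) t).trans ?_
  refine (lintegral_enorm_mul_le_weightedNorm (c := 2 * Real.pi * r)
    (continuous_fourier (hk.sub hgi)).aestronglyMeasurable hX.1).trans ?_
  gcongr

lemma exists_predictingKernels_predictionError_le {r T θ : ℝ} (hr : 0 < r) (hT : 0 < T)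
    (hθ : 0 ≤ θ) {h : ℝ → ℝ} (hh : h ∈ targetKernels θ T) {ε : ℝ≥0∞} (hε : ε ≠ 0) :
    ∃ g ∈ predictingKernels (T + θ), ∀ x ∈ processClass r,
      predictionError T (T + θ) h g x ≤ ε * weightedNorm r (fourierAxis x) := by
  have hk : Integrable ((Set.Ico (-T) 0).indicator fun u => (h u : ℂ)) := by
    refine IntegrableOn.integrable_indicator ?_ measurableSet_Ico
    have hcont : Continuous fun u => (h u : ℂ) := Complex.continuous_ofReal.comp hh.1.continuous
    exact (hcont.integrableOn_Icc).mono_set Set.Ico_subset_Icc_self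
  obtain ⟨g, hg, hlt⟩ := exists_testKernels_eLpNorm_lt (c := 2 * Real.pi * r) (τ := T + θ)
    (by positivity) (by positivity) hk hε
  refine ⟨g, testKernels_subset_predictingKernels _ hg, fun x hx => ?_⟩
  refine (predictionError_le hr hT.le (by positivity) hk hg hx).trans ?_
  gcongr

end WeakPrediction

theorem theorem1 (r T θ : ℝ) (hr : 0 < r) (hT : 0 < T) (hθ : 0 ≤ θ) :
    WeakPrediction.IsWeaklyPredictable (WeakPrediction.processClass r) (T + θ) θ T ∧
      WeakPrediction.IsUniformlyWeaklyPredictable (WeakPrediction.unitBallClass r)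
        (WeakPrediction.weightedNorm r) (T + θ) θ T := by
  have key : ∀ h ∈ WeakPrediction.targetKernels θ T, ∃ g : ℕ → ℝ → ℂ,
      (∀ d, g d ∈ WeakPrediction.predictingKernels (T + θ)) ∧
      ∀ d, ∀ x ∈ WeakPrediction.processClass r,
        WeakPrediction.predictionError T (T + θ) h (g d) x ≤
          (d : ℝ≥0∞)⁻¹ * WeakPrediction.weightedNorm r (WeakPrediction.fourierAxis x) := by
    intro h hh
    -- At `d = 0` the tolerance is `⊤`, which is harmless for the limit.
    choose g hg hle using fun d : ℕ =>
      WeakPrediction.exists_predictingKernels_predictionError_le hr hT hθ hh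
        (ε := (d : ℝ≥0∞)⁻¹) (by simp)
    exact ⟨g, hg, hle⟩
  refine ⟨fun h hh => ?_, fun h hh => ?_⟩
  · obtain ⟨g, hg, hle⟩ := key h hh
    refine ⟨g, hg, fun x hx => ?_⟩
    refine tendsto_of_tendsto_of_tendsto_of_le_of_le tendsto_const_nhds ?_
      (fun d => zero_le) (fun d => hle d x hx)
    simpa using ENNReal.Tendsto.mul_const ENNReal.tendsto_inv_nat_nhds_zero
      (Or.inr hx.2.2.ne)
  · obtain ⟨g, hg, hle⟩ := key h hh
    refine ⟨g, hg, ?_⟩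
    refine tendsto_of_tendsto_of_tendsto_of_le_of_le tendsto_const_nhds
      ENNReal.tendsto_inv_nat_nhds_zero (fun d => zero_le) (fun d => ?_)
    refine iSup₂_le fun x hx => (hle d x hx.1.1).trans ?_
    exact mul_le_of_le_one_right' hx.2
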